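/- Let $d_A,d_B\ge 1$, $n\ge 1$, and let $\rho_1,\dots,\rho_n$ be density operators (positive semidefinite, trace one) on $\mathbb{C}^{d_A}\otimes\mathbb{C}^{d_B}$ that form a full orthogonal set, that is, $\operatorname{tr}(\rho_i\rho_j)=0$ for all $i\neq j$ and $\sum_{i}\rho_i$ has full rank $d_Ad_B$. Assume that there is an index $i_0$ such that for every $i\neq i_0$ the state $\rho_i$ is a tensor product, $\rho_i=\sigma_i\otimes\tau_i$, where $\sigma_i$ acts on $\mathbb{C}^{d_A}$ and $\tau_i$ on $\mathbb{C}^{d_B}$; nothing is assumed of this kind about $\rho_{i_0}$. A finite LOCC protocol consists of finitely many rounds, in each of which one of the two parties applies a local quantum instrument to their system (possibly changing its finite dimension), chosen depending on the previously communicated outcomes, and communicates the (finitely valued) outcome to the other party; at the end a result in $\{1,\dots,n\}$ is declared as a function of the communicated outcomes. Such a protocol implements an $n$-outcome POVM on $\mathbb{C}^{d_A}\otimes\mathbb{C}^{d_B}$. A POVM $(M_1,\dots,M_n)$ is in finite LOCC if it is implemented exactly by a finite LOCC protocol, and it is in asymptotic LOCC if it is the limit of a sequence of POVMs each implemented by a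 finite LOCC protocol. The states can be discriminated with finite (respectively asymptotic) LOCC if there is a POVM $(M_1,\dots,M_n)$ in finite (respectively asymptotic) LOCC with $\operatorname{tr}(M_j\rho_i)=\delta_{ij}$ for all $i,j$. If $\rho_1,\dots,\rho_n$ can be discriminated with asymptotic LOCC, then they can be discriminated with finite LOCC. -/

import Mathlib

open scoped Kronecker Matrix ComplexOrder

namespace LOCC

/-- Operators on the bipartite space `ℂ^dA ⊗ ℂ^dB`, in the product basis. -/
abbrev BipOp (dA dB : ℕ) : Type := Matrix (Fin dA × Fin dB) (Fin dA × Fin dB) ℂ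

/-- A local quantum operation with a classical outcome (a quantum instrument) on `ℂ^d`, in Kraus
form. Outcome `k` occurs with the completely positive map `X ↦ ∑ j, K k j * X * (K k j)ᴴ`, whose
output system `ℂ^(outDim k)` is arbitrary and may depend on the outcome; the sum of these maps over
all outcomes is trace preserving. -/
structure Instrument (d : ℕ) where
  numOutcomes : ℕ
  outDim : Fin numOutcomes → ℕ
  numKraus : Fin numOutcomes → ℕ
  kraus : (k : Fin numOutcomes) → Fin (numKraus k) → Matrix (Fin (outDim k)) (Fin d) ℂ
  complete : ∑ k, ∑ j, (kraus k j)ᴴ * kraus k j = 1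

/-- Finite LOCC protocols for measuring a state of `ℂ^dA ⊗ ℂ^dB` with final result in `ι`: finite
trees. Either the parties stop and declare a result, or one of them applies a local instrument,
announces its outcome to the other, and they continue with a protocol that depends on it. -/
inductive Protocol (ι : Type) : ℕ → ℕ → Type
  | declare {dA dB : ℕ} (i : ι) : Protocol ι dA dB
  | alice {dA dB : ℕ} (I : Instrument dA)
      (next : (k : Fin I.numOutcomes) → Protocol ι (I.outDim k) dB) : Protocol ι dA dB
  | bob {dA dB : ℕ} (I : Instrument dB)
      (next : (k : Fin I.numOutcomes) → Protocol ι dA (I.outDim k)) : Protocol ι dA dB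

/-- The POVM that a protocol implements: on input `ρ`, the result is `i` with probability
`trace (P.povm i * ρ)`. -/
noncomputable def Protocol.povm {ι : Type} [DecidableEq ι] :
    {dA dB : ℕ} → Protocol ι dA dB → ι → BipOp dA dB
  | _, _, .declare i₀ => fun i => if i = i₀ then 1 else 0
  | _, dB, .alice I next => fun i => ∑ k, ∑ j,
      (I.kraus k j ⊗ₖ (1 : Matrix (Fin dB) (Fin dB) ℂ))ᴴ * (next k).povm i *
        (I.kraus k j ⊗ₖ (1 : Matrix (Fin dB) (Fin dB) ℂ))
  | dA, _, .bob I next => fun i => ∑ k, ∑ j,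
      ((1 : Matrix (Fin dA) (Fin dA) ℂ) ⊗ₖ I.kraus k j)ᴴ * (next k).povm i *
        ((1 : Matrix (Fin dA) (Fin dA) ℂ) ⊗ₖ I.kraus k j)

/-- The measurement `M` can be implemented exactly by a finite LOCC protocol. -/
def IsFiniteLOCC {ι : Type} [DecidableEq ι] {dA dB : ℕ} (M : ι → BipOp dA dB) : Prop :=
  ∃ P : Protocol ι dA dB, P.povm = M

/-- The measurement `M` can be implemented with vanishing error by a sequence of finite LOCC
protocols. -/
def IsAsymptoticLOCC {ι : Type} [DecidableEq ι] {dA dB : ℕ} (M : ι → BipOp dA dB) : Prop :=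
  ∃ P : ℕ → Protocol ι dA dB,
    Filter.Tendsto (fun t => (P t).povm) Filter.atTop (nhds M)

/-- The measurement `M` identifies the states `ρ i` without error. -/
def Discriminates {ι : Type} [DecidableEq ι] {dA dB : ℕ} (M ρ : ι → BipOp dA dB) : Prop :=
  ∀ i j, (M j * ρ i).trace = if j = i then 1 else 0

/-- Density operators. -/
def IsState {dA dB : ℕ} (ρ : BipOp dA dB) : Prop := ρ.PosSemidef ∧ ρ.trace = 1

/-- Mutually orthogonal states whose sum has full rank. -/
structure IsFullOrthogonalSet {ι : Type} [Fintype ι] {dA dB : ℕ} (ρ : ι → BipOp dA dB) : Prop where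
  isState : ∀ i, IsState (ρ i)
  orthogonal : ∀ i j, i ≠ j → (ρ i * ρ j).trace = 0
  fullRank : (∑ i, ρ i).rank = dA * dB

end LOCC

/-! Perfect discrimination of a full orthogonal set forces the measurement `M` to be projective: `M
i` projects onto the range of `ρ i`, so all projectors but one are products. It remains to turn an
asymptotic protocol for such a projective measurement into a finite one.

Suppose no projector is the identity. Along a protocol tree the accumulated effect `Kᴴ * K ⊗ₖ Lᴴ *
L` starts at a multiple of the identity, while a final decision made close to that point has error
bounded below. Each branching alters one tensor factor only, so the segment from a node to its child
consists of product operators, and leaving a small ball means crossing its boundary sphere. If every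
product family on that sphere had positive error, compactness and `mul_le_of_sum` would bound the
error of all protocols away from zero. Hence some family on the sphere has zero error, and its sum
is a non-scalar `A ⊗ₖ B` commuting with every projector (`exists_commuting_product`).

By `commute_of_commute_kronecker`, `A` and `B` commute with the factors of each nonzero product
projector, hence so do their spectral projectors; the exceptional projector follows by
complementation. A local spectral measurement of `A` or `B` therefore splits the problem into
smaller ones of the same kind, and induction on `dA + dB` finishes. -/

namespace LOCC

/-! ### Positive matrices, range projectors and spectral splittings -/

section LinearAlgebra

variable {n : Type*} [Fintype n] [DecidableEq n]

open scoped MatrixOrder in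
/-- A positive semidefinite matrix is of the form `Uᴴ * U`. -/
theorem exists_eq_conjTranspose_mul_self {A : Matrix n n ℂ} (hA : A.PosSemidef) :
    ∃ U : Matrix n n ℂ, A = Uᴴ * U :=
  CStarAlgebra.nonneg_iff_eq_star_mul_self.mp hA.nonneg

theorem trace_mul_nonneg {A B : Matrix n n ℂ} (hA : A.PosSemidef) (hB : B.PosSemidef) :
    0 ≤ (A * B).trace := by
  obtain ⟨V, rfl⟩ := exists_eq_conjTranspose_mul_self hB
  rw [← Matrix.mul_assoc, Matrix.trace_mul_comm, ← Matrix.mul_assoc]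
  exact (hA.mul_mul_conjTranspose_same V).trace_nonneg

/-- With `A = Uᴴ * U` and `B = Vᴴ * V`, the trace is the squared Hilbert–Schmidt norm of `U * Vᴴ`.
-/
theorem mul_eq_zero_of_trace_mul_eq_zero {A B : Matrix n n ℂ} (hA : A.PosSemidef)
    (hB : B.PosSemidef) (h : (A * B).trace = 0) : A * B = 0 := by
  obtain ⟨U, rfl⟩ := exists_eq_conjTranspose_mul_self hA
  obtain ⟨V, rfl⟩ := exists_eq_conjTranspose_mul_self hB
  have h1 : ((U * Vᴴ)ᴴ * (U * Vᴴ)).trace = 0 := by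
    rw [← h, ← Matrix.mul_assoc (Uᴴ * U), Matrix.trace_mul_comm _ V]
    simp [Matrix.mul_assoc]
  have h2 : U * Vᴴ = 0 := Matrix.trace_conjTranspose_mul_self_eq_zero_iff.mp h1
  calc Uᴴ * U * (Vᴴ * V) = Uᴴ * (U * Vᴴ) * V := by simp only [Matrix.mul_assoc]
    _ = 0 := by simp [h2]

theorem exists_unitary_diagonalization {A : Matrix n n ℂ} (hA : A.IsHermitian) :
    ∃ (U : Matrix n n ℂ) (l : n → ℝ), Uᴴ * U = 1 ∧ U * Uᴴ = 1 ∧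
      A = U * Matrix.diagonal (fun x => (l x : ℂ)) * Uᴴ := by
  refine ⟨hA.eigenvectorUnitary, hA.eigenvalues, ?_, ?_, ?_⟩
  · exact Unitary.coe_star_mul_self hA.eigenvectorUnitary
  · exact Unitary.coe_mul_star_self hA.eigenvectorUnitary
  · conv_lhs => rw [hA.spectral_theorem, Unitary.conjStarAlgAut_apply]
    rfl

/-- The orthogonal projector onto the range of a matrix. -/
theorem exists_range_projector (S : Matrix n n ℂ) :
    ∃ a x : Matrix n n ℂ, aᴴ = a ∧ a * S = S ∧ a = S * x := by
  obtain ⟨U, l, hU, hU', hA⟩ :=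
    exists_unitary_diagonalization (Matrix.isHermitian_mul_conjTranspose_self S)
  set a := U * Matrix.diagonal (fun x => if l x = 0 then (0 : ℂ) else 1) * Uᴴ with ha
  have key : ∀ f g : n → ℂ, (U * Matrix.diagonal f * Uᴴ) * (U * Matrix.diagonal g * Uᴴ)
      = U * Matrix.diagonal (fun x => f x * g x) * Uᴴ := by
    intro f g
    calc (U * Matrix.diagonal f * Uᴴ) * (U * Matrix.diagonal g * Uᴴ)
        = U * Matrix.diagonal f * (Uᴴ * U) * Matrix.diagonal g * Uᴴ := by
          simp only [Matrix.mul_assoc]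
      _ = U * (Matrix.diagonal f * Matrix.diagonal g) * Uᴴ := by
          rw [hU]; simp only [Matrix.mul_assoc, Matrix.one_mul]
      _ = _ := by rw [Matrix.diagonal_mul_diagonal]
  have haH : aᴴ = a := by
    rw [ha]
    simp only [Matrix.conjTranspose_mul, Matrix.conjTranspose_conjTranspose,
      Matrix.diagonal_conjTranspose, Matrix.mul_assoc]
    congr 3
    ext x
    by_cases hx : l x = 0 <;> simp [hx]
  have haS : a * (S * Sᴴ) = S * Sᴴ := by
    rw [hA, ha, key]
    congr 3
    ext x
    by_cases hx : l x = 0 <;> simp [hx]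
  -- The inverse is a pseudo-inverse: `0⁻¹ = 0` matches the zero entries of `a`.
  refine ⟨a, Sᴴ * (U * Matrix.diagonal (fun x => ((l x)⁻¹ : ℂ)) * Uᴴ), haH, ?_, ?_⟩
  · have h0 : (1 - a) * S * Sᴴ = 0 := by
      rw [Matrix.mul_assoc, Matrix.sub_mul, haS, Matrix.one_mul, sub_self]
    rw [Matrix.mul_assoc, Matrix.mul_self_mul_conjTranspose_eq_zero, Matrix.sub_mul, Matrix.one_mul] at h0
    exact (sub_eq_zero.mp h0).symm
  · rw [← Matrix.mul_assoc, hA, key, ha]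
    congr 3
    ext x
    by_cases hx : l x = 0 <;> simp [hx]

/-- A hermitian matrix that is not scalar splits the space into two proper orthogonal subspaces,
whose projectors commute with everything that commutes with the matrix. -/
theorem exists_isometries_of_not_scalar {d : ℕ} {A : Matrix (Fin d) (Fin d) ℂ}
    (hA : A.IsHermitian) (hns : ∀ c : ℂ, A ≠ c • 1) :
    ∃ (m : Fin 2 → ℕ) (V : (k : Fin 2) → Matrix (Fin d) (Fin (m k)) ℂ),
      (∀ k, m k < d) ∧ (∀ k, (V k)ᴴ * V k = 1) ∧ ∑ k, V k * (V k)ᴴ = 1 ∧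
      ∀ k a, A * a = a * A → V k * (V k)ᴴ * a = a * (V k * (V k)ᴴ) := by
  obtain ⟨U, l, hU, hU', hAU⟩ := exists_unitary_diagonalization hA
  obtain ⟨x₀, x₁, hx⟩ : ∃ x₀ x₁, l x₀ ≠ l x₁ := by
    by_contra! hcon
    rcases isEmpty_or_nonempty (Fin d) with h | ⟨⟨x₀⟩⟩
    · exact hns 0 (Subsingleton.elim _ _)
    · apply hns (l x₀)
      have : (fun x => (l x : ℂ)) = fun _ => (l x₀ : ℂ) := by
        ext x; rw [hcon x x₀]
      rw [hAU, this, ← Matrix.smul_one_eq_diagonal, Matrix.mul_smul, Matrix.smul_mul, Matrix.mul_one, hU']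
  -- One eigenvalue against all the others; `x₀` and `x₁` make both classes nonempty, hence both
  -- proper.
  let p : Fin d → Fin 2 := fun x => if l x = l x₀ then 0 else 1
  let e : (k : Fin 2) → Fin (Fintype.card {x // p x = k}) ≃ {x // p x = k} :=
    fun k => (Fintype.equivFin _).symm
  have hVV : ∀ k, U.submatrix id (fun y => (e k y).1) * (U.submatrix id (fun y => (e k y).1))ᴴ
      = U * Matrix.diagonal (fun x => if p x = k then (1 : ℂ) else 0) * Uᴴ := by
    intro k
    ext i j
    rw [Matrix.mul_apply, Matrix.mul_apply]
    simp only [Matrix.mul_diagonal, Matrix.submatrix_apply, Matrix.conjTranspose_apply, id]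
    rw [(e k).sum_comp (fun y : {x // p x = k} => U i y.1 * star (U j y.1)),
      ← Finset.sum_subtype (Finset.univ.filter fun x => p x = k) (by simp)
        (fun y => U i y * star (U j y)), Finset.sum_filter]
    refine Finset.sum_congr rfl fun x _ => ?_
    split_ifs <;> simp
  refine ⟨fun k => Fintype.card {x // p x = k}, fun k => U.submatrix id (fun y => (e k y).1),
    ?_, ?_, ?_, ?_⟩
  · intro k
    have : ∃ x, p x ≠ k := by
      fin_cases k
      · exact ⟨x₁, by simp [p, hx.symm]⟩
      · exact ⟨x₀, by simp [p]⟩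
    obtain ⟨x, hx⟩ := this
    simpa using Fintype.card_subtype_lt (p := fun x => p x = k) hx
  · intro k
    ext y z
    have := congrFun (congrFun hU (e k y).1) (e k z).1
    rw [Matrix.mul_apply] at this ⊢
    simp only [Matrix.submatrix_apply, Matrix.conjTranspose_apply, id] at this ⊢
    rw [this]
    simp only [Matrix.one_apply, Subtype.val_inj, (e k).injective.eq_iff]
  · simp only [hVV]
    have h1 : ∑ k, Matrix.diagonal (fun x => if p x = k then (1 : ℂ) else 0) = 1 := by
      ext i j
      by_cases hij : i = j
      · subst hij
        simp [Matrix.sum_apply, -Fin.sum_univ_two]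
      · simp [Matrix.sum_apply, hij]
    rw [← Finset.sum_mul, ← Finset.mul_sum, h1, Matrix.mul_one, hU']
  · intro k a ha
    rw [hVV]
    set b := Uᴴ * a * U with hb
    have hab : a = U * b * Uᴴ := by
      calc a = (U * Uᴴ) * a * (U * Uᴴ) := by simp [hU']
        _ = _ := by simp only [hb, Matrix.mul_assoc]
    have hconj : ∀ f : Fin d → ℂ, U * Matrix.diagonal f * Uᴴ * a = a * (U * Matrix.diagonal f * Uᴴ)
        ↔ Matrix.diagonal f * b = b * Matrix.diagonal f := by
      intro f
      have e1 : U * Matrix.diagonal f * Uᴴ * a = U * (Matrix.diagonal f * b) * Uᴴ := by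
        calc _ = U * Matrix.diagonal f * Uᴴ * a * (U * Uᴴ) := by simp [hU']
          _ = _ := by simp only [hb, Matrix.mul_assoc]
      have e2 : a * (U * Matrix.diagonal f * Uᴴ) = U * (b * Matrix.diagonal f) * Uᴴ := by
        calc _ = (U * Uᴴ) * a * (U * Matrix.diagonal f * Uᴴ) := by simp [hU']
          _ = _ := by simp only [hb, Matrix.mul_assoc]
      rw [e1, e2]
      refine ⟨fun h => ?_, fun h => by rw [h]⟩
      have h' := congrArg (fun X => Uᴴ * X * U) h
      have e3 : ∀ X, Uᴴ * (U * X * Uᴴ) * U = X := fun X => by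
        calc _ = (Uᴴ * U) * X * (Uᴴ * U) := by simp only [Matrix.mul_assoc]
          _ = X := by simp [hU]
      simpa only [e3] using h'
    rw [hconj]
    rw [hAU, hconj] at ha
    ext i j
    have hij := congrFun (congrFun ha i) j
    simp only [Matrix.diagonal_mul, Matrix.mul_diagonal] at hij ⊢
    -- In the eigenbasis `b` is block diagonal along the eigenvalues of `A`, and `p` is constant on
    -- each eigenvalue.
    by_cases hl : l i = l j
    · have : p i = p j := by simp [p, hl]
      rw [this, mul_comm]
    · have : b i j = 0 := by
        have h0 : ((l i : ℂ) - l j) * b i j = 0 := by rw [sub_mul, hij]; ring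
        rcases mul_eq_zero.mp h0 with h | h
        · exact absurd (by exact_mod_cast sub_eq_zero.mp h) hl
        · exact h
      simp [this]

end LinearAlgebra

/-! ### Protocols implement POVMs -/

section Protocols

variable {ι : Type} [DecidableEq ι]

theorem sum_povm [Fintype ι] {dA dB : ℕ} (P : Protocol ι dA dB) : ∑ i, P.povm i = 1 := by
  induction P with
  | declare i => simp [Protocol.povm]
  | @alice dA dB I next ih =>
    simp only [Protocol.povm]
    rw [Finset.sum_comm]
    simp only [Finset.sum_comm (s := (Finset.univ : Finset ι))]
    simp only [← Matrix.sum_mul, ← Matrix.mul_sum, ih, Matrix.mul_one, Matrix.conjTranspose_kronecker,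
      ← Matrix.mul_kronecker_mul, Matrix.conjTranspose_one]
    have := congrArg (fun X => X ⊗ₖ (1 : Matrix (Fin dB) (Fin dB) ℂ)) I.complete
    simp only [Matrix.one_kronecker_one] at this
    rw [← this]
    ext i j
    simp [Matrix.sum_apply, Finset.sum_mul]
  | @bob dA dB I next ih =>
    simp only [Protocol.povm]
    rw [Finset.sum_comm]
    simp only [Finset.sum_comm (s := (Finset.univ : Finset ι))]
    simp only [← Matrix.sum_mul, ← Matrix.mul_sum, ih, Matrix.mul_one, Matrix.conjTranspose_kronecker,
      ← Matrix.mul_kronecker_mul, Matrix.conjTranspose_one]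
    have := congrArg (fun X => (1 : Matrix (Fin dA) (Fin dA) ℂ) ⊗ₖ X) I.complete
    simp only [Matrix.one_kronecker_one] at this
    rw [← this]
    ext i j
    simp [Matrix.sum_apply, Finset.mul_sum]

theorem povm_posSemidef {dA dB : ℕ} (P : Protocol ι dA dB) (i : ι) : (P.povm i).PosSemidef := by
  induction P with
  | declare j =>
    simp only [Protocol.povm]
    split_ifs
    · exact Matrix.PosSemidef.one
    · exact Matrix.PosSemidef.zero
  | alice I next ih =>
    exact Matrix.posSemidef_sum _ fun k _ => Matrix.posSemidef_sum _ fun j _ =>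
      (ih k).conjTranspose_mul_mul_same _
  | bob I next ih =>
    exact Matrix.posSemidef_sum _ fun k _ => Matrix.posSemidef_sum _ fun j _ =>
      (ih k).conjTranspose_mul_mul_same _

end Protocols

/-! ### The crossing argument at one branching -/

/-- If a vector near the center is a sum of vectors that it is joined to by segments in `G`, and the
error of vectors on the sphere of radius `χ` is bounded below, then the lower bound on the error
passes from the summands to the sum. -/
theorem mul_le_of_sum {V : Type*} [AddCommGroup V] [Module ℝ V] [TopologicalSpace V]
    [ContinuousAdd V] [ContinuousSMul ℝ V] (tr err : V →ₗ[ℝ] ℝ) {g : V → ℝ} (hg : Continuous g)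
    {G : Set V} {δ χ : ℝ} (hδ : ∀ x ∈ G, tr x = 1 → g x = χ → δ ≤ err x)
    {κ : Type*} [Fintype κ] {x : V} {y : κ → V} (hxy : x = ∑ c, y c)
    (hG : ∀ c, ∀ s t : ℝ, 0 ≤ s → 0 ≤ t → s • x + t • y c ∈ G)
    (htr : ∀ c, 0 ≤ tr (y c)) (herr : ∀ c, 0 ≤ err (y c))
    (hx : 0 < tr x) (hgx : g ((tr x)⁻¹ • x) < χ)
    (ih : ∀ c, 0 < tr (y c) → g ((tr (y c))⁻¹ • y c) < χ → δ * tr (y c) ≤ err (y c)) :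
    δ * tr x ≤ err x := by
  -- If the error per unit trace at `x` is below `δ`, then every summand has error rate at least
  -- `δ`, and summing contradicts this.
  by_contra! hcon
  have key : ∀ c, δ * tr (y c) ≤ err (y c) := by
    intro c
    rcases (htr c).eq_or_lt with h0 | hpos
    · rw [← h0, mul_zero]
      exact herr c
    by_cases hn : g ((tr (y c))⁻¹ • y c) < χ
    · exact ih c hpos hn
    rw [not_lt] at hn
    -- The segment between the normalized vectors starts inside the sphere and ends on or outside
    -- it.
    let φ : ℝ → ℝ := fun t => g ((1 - t) • ((tr x)⁻¹ • x) + t • ((tr (y c))⁻¹ • y c))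
    have hφ : Continuous φ := by fun_prop
    obtain ⟨t, ⟨ht0, ht1⟩, ht⟩ : χ ∈ φ '' Set.Icc 0 1 :=
      intermediate_value_Icc zero_le_one hφ.continuousOn
        ⟨by simpa [φ] using hgx.le, by simpa [φ] using hn⟩
    have hmem := hδ ((1 - t) • ((tr x)⁻¹ • x) + t • ((tr (y c))⁻¹ • y c)) (by
        rw [smul_smul, smul_smul]
        exact hG c _ _ (mul_nonneg (by linarith) (by positivity)) (by positivity))
      (by simp [hx.ne', hpos.ne']) ht
    simp only [map_add, map_smul, smul_eq_mul] at hmem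
    have e1 : (tr x)⁻¹ * err x < δ := by rwa [inv_mul_lt_iff₀ hx, mul_comm]
    -- The error is affine along the segment: below `δ` at the start and at least `δ` at the
    -- crossing, so at least `δ` at the end.
    have e2 : δ ≤ (tr (y c))⁻¹ * err (y c) := by
      by_contra! h2
      rcases ht0.eq_or_lt with h | h
      · rw [← h] at hmem
        linarith
      · have := mul_lt_mul_of_pos_left h2 h
        have := mul_le_mul_of_nonneg_left e1.le (sub_nonneg.mpr ht1)
        linarith
    rwa [le_inv_mul_iff₀ hpos, mul_comm] at e2
  have := Finset.sum_le_sum fun c (_ : c ∈ Finset.univ) => key c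
  rw [← Finset.mul_sum, ← map_sum, ← map_sum, ← hxy] at this
  linarith

/-! ### Product families and their error -/

section Families

variable {ι : Type} [Fintype ι] {dA dB : ℕ}

/-- Families of positive operators whose sum is a product operator. -/
def productFamilies (ι : Type) [Fintype ι] (dA dB : ℕ) : Set (ι → BipOp dA dB) :=
  {X | (∀ i, (X i).PosSemidef) ∧ ∃ (A : Matrix (Fin dA) (Fin dA) ℂ) (B : Matrix (Fin dB) (Fin dB) ℂ),
    A.PosSemidef ∧ B.PosSemidef ∧ ∑ i, X i = A ⊗ₖ B}

/-- The trace of the sum of a family. -/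
noncomputable def totalTrace (ι : Type) [Fintype ι] (dA dB : ℕ) : (ι → BipOp dA dB) →ₗ[ℝ] ℝ where
  toFun X := ∑ i, (X i).trace.re
  map_add' X Y := by simp [Matrix.trace_add, Finset.sum_add_distrib]
  map_smul' r X := by simp [Matrix.trace_smul, Finset.mul_sum]

/-- The weight of a family outside the projectors `Q`: for a measurement this is its error. -/
noncomputable def errorWeight (Q : ι → BipOp dA dB) : (ι → BipOp dA dB) →ₗ[ℝ] ℝ where
  toFun X := ∑ i, (X i * (1 - Q i)).trace.re
  map_add' X Y := by simp [Matrix.trace_add, Finset.sum_add_distrib, add_mul]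
  map_smul' r X := by simp [Matrix.trace_smul, Finset.mul_sum]

theorem totalTrace_apply (X : ι → BipOp dA dB) :
    totalTrace ι dA dB X = (∑ i, X i).trace.re := by
  simp [totalTrace, Matrix.trace_sum]

theorem errorWeight_apply (Q X : ι → BipOp dA dB) :
    errorWeight Q X = ∑ i, (X i * (1 - Q i)).trace.re := rfl

theorem totalTrace_nonneg {X : ι → BipOp dA dB} (hX : ∀ i, (X i).PosSemidef) :
    0 ≤ totalTrace ι dA dB X :=
  Finset.sum_nonneg fun i _ => (Complex.le_def.mp (hX i).trace_nonneg).1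

theorem errorWeight_nonneg {Q X : ι → BipOp dA dB} (hQ : ∀ i, (1 - Q i).PosSemidef)
    (hX : ∀ i, (X i).PosSemidef) : 0 ≤ errorWeight Q X :=
  Finset.sum_nonneg fun i _ => (Complex.le_def.mp (trace_mul_nonneg (hX i) (hQ i))).1

end Families

/-! ### The error bound along a protocol tree -/

section Pullback

variable {ι : Type} [DecidableEq ι] {dA dB : ℕ}

/-- The measurement on `ℂ^dA ⊗ ℂ^dB` obtained by applying `K ⊗ L` and then the protocol `P`. -/
noncomputable def pullback {eA eB : ℕ} (P : Protocol ι eA eB)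
    (K : Matrix (Fin eA) (Fin dA) ℂ) (L : Matrix (Fin eB) (Fin dB) ℂ) (i : ι) : BipOp dA dB :=
  (K ⊗ₖ L)ᴴ * P.povm i * (K ⊗ₖ L)

theorem pullback_posSemidef {eA eB : ℕ} (P : Protocol ι eA eB)
    (K : Matrix (Fin eA) (Fin dA) ℂ) (L : Matrix (Fin eB) (Fin dB) ℂ) (i : ι) :
    (pullback P K L i).PosSemidef :=
  (povm_posSemidef P i).conjTranspose_mul_mul_same _

/-- The outcomes of `P` sum to the identity, so the accumulated effect at a node is a product
whatever protocol follows. -/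
theorem sum_pullback [Fintype ι] {eA eB : ℕ} (P : Protocol ι eA eB)
    (K : Matrix (Fin eA) (Fin dA) ℂ) (L : Matrix (Fin eB) (Fin dB) ℂ) :
    ∑ i, pullback P K L i = (Kᴴ * K) ⊗ₖ (Lᴴ * L) := by
  simp only [pullback, ← Matrix.sum_mul, ← Matrix.mul_sum, sum_povm, Matrix.mul_one]
  rw [Matrix.conjTranspose_kronecker, Matrix.mul_kronecker_mul]

theorem pullback_alice {eA eB : ℕ} (I : Instrument eA)
    (next : (k : Fin I.numOutcomes) → Protocol ι (I.outDim k) eB)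
    (K : Matrix (Fin eA) (Fin dA) ℂ) (L : Matrix (Fin eB) (Fin dB) ℂ) :
    pullback (.alice I next) K L =
      ∑ c : (k : Fin I.numOutcomes) × Fin (I.numKraus k),
        pullback (next c.1) (I.kraus c.1 c.2 * K) L := by
  ext1 i
  rw [Fintype.sum_sigma, Finset.sum_apply]
  simp only [Finset.sum_apply, pullback, Protocol.povm, Matrix.mul_sum, Matrix.sum_mul]
  refine Finset.sum_congr rfl fun k _ => Finset.sum_congr rfl fun j _ => ?_
  have : (I.kraus k j * K) ⊗ₖ L =
      (I.kraus k j ⊗ₖ (1 : Matrix (Fin eB) (Fin eB) ℂ)) * (K ⊗ₖ L) := by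
    rw [← Matrix.mul_kronecker_mul, Matrix.one_mul]
  rw [this, Matrix.conjTranspose_mul]
  simp only [Matrix.mul_assoc]

theorem pullback_bob {eA eB : ℕ} (I : Instrument eB)
    (next : (k : Fin I.numOutcomes) → Protocol ι eA (I.outDim k))
    (K : Matrix (Fin eA) (Fin dA) ℂ) (L : Matrix (Fin eB) (Fin dB) ℂ) :
    pullback (.bob I next) K L =
      ∑ c : (k : Fin I.numOutcomes) × Fin (I.numKraus k),
        pullback (next c.1) K (I.kraus c.1 c.2 * L) := by
  ext1 i
  rw [Fintype.sum_sigma, Finset.sum_apply]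
  simp only [Finset.sum_apply, pullback, Protocol.povm, Matrix.mul_sum, Matrix.sum_mul]
  refine Finset.sum_congr rfl fun k _ => Finset.sum_congr rfl fun j _ => ?_
  have : K ⊗ₖ (I.kraus k j * L) =
      ((1 : Matrix (Fin eA) (Fin eA) ℂ) ⊗ₖ I.kraus k j) * (K ⊗ₖ L) := by
    rw [← Matrix.mul_kronecker_mul, Matrix.one_mul]
  rw [this, Matrix.conjTranspose_mul]
  simp only [Matrix.mul_assoc]

theorem posSemidef_smul_add_smul {n : Type*} [Fintype n] {A B : Matrix n n ℂ} (hA : A.PosSemidef)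
    (hB : B.PosSemidef) {s t : ℝ} (hs : 0 ≤ s) (ht : 0 ≤ t) : (s • A + t • B).PosSemidef :=
  (hA.smul hs).add (hB.smul ht)

open scoped Matrix.Norms.Elementwise

/-- A lower bound on the error of every protocol, given one for product families at distance `χ`
from `C` and one for final decisions at distance less than `χ`. -/
theorem mul_totalTrace_le_errorWeight [Fintype ι] {Q : ι → BipOp dA dB} (hQ : ∀ i, (1 - Q i).PosSemidef)
    {C : BipOp dA dB} {δ χ : ℝ}
    (hδ : ∀ X ∈ productFamilies ι dA dB, totalTrace ι dA dB X = 1 → ‖∑ i, X i - C‖ = χ →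
      δ ≤ errorWeight Q X)
    (hleaf : ∀ E : BipOp dA dB, ‖E - C‖ < χ → ∀ i, δ ≤ (E * (1 - Q i)).trace.re)
    {eA eB : ℕ} (P : Protocol ι eA eB) (K : Matrix (Fin eA) (Fin dA) ℂ)
    (L : Matrix (Fin eB) (Fin dB) ℂ) (hpos : 0 < totalTrace ι dA dB (pullback P K L))
    (hnear : ‖∑ i, ((totalTrace ι dA dB (pullback P K L))⁻¹ • pullback P K L) i - C‖ < χ) :
    δ * totalTrace ι dA dB (pullback P K L) ≤ errorWeight Q (pullback P K L) := by
  have hg : Continuous fun X : ι → BipOp dA dB => ‖∑ i, X i - C‖ := by fun_prop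
  induction P with
  | @declare eA eB j =>
    have h := hleaf _ hnear j
    set r := totalTrace ι dA dB (pullback (.declare j) K L)
    -- At a leaf the whole weight sits on the declared result, so its error is the one bounded by
    -- `hleaf`.
    have e : errorWeight Q (r⁻¹ • pullback (.declare j) K L) =
        (((∑ i, (r⁻¹ • pullback (.declare j) K L) i)) * (1 - Q j)).trace.re := by
      have h0 : ∀ i, i ≠ j → pullback (.declare j : Protocol ι eA eB) K L i = 0 := by
        intro i hi
        simp [pullback, Protocol.povm, hi]
      rw [errorWeight_apply, Finset.sum_eq_single j, Finset.sum_eq_single j]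
      · intro i _ hi; simp [h0 i hi]
      · simp
      · intro i _ hi; simp [h0 i hi]
      · simp
    rw [← e, map_smul, smul_eq_mul, le_inv_mul_iff₀ hpos, mul_comm] at h
    exact h
  | alice I next ih =>
    refine mul_le_of_sum _ _ hg hδ (pullback_alice I next K L) ?_
      (fun c => totalTrace_nonneg (pullback_posSemidef _ _ _))
      (fun c => errorWeight_nonneg hQ (pullback_posSemidef _ _ _)) hpos hnear
      (fun c => ih c.1 _ _)
    -- Locality enters here: parent and child share Bob's factor `Lᴴ * L`, so their nonnegative
    -- combinations remain products.
    intro c s t hs ht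
    refine ⟨fun i => posSemidef_smul_add_smul (pullback_posSemidef _ _ _ _)
      (pullback_posSemidef _ _ _ _) hs ht, s • (Kᴴ * K) +
        t • ((I.kraus c.1 c.2 * K)ᴴ * (I.kraus c.1 c.2 * K)), Lᴴ * L,
        posSemidef_smul_add_smul (Matrix.posSemidef_conjTranspose_mul_self _)
        (Matrix.posSemidef_conjTranspose_mul_self _) hs ht,
        Matrix.posSemidef_conjTranspose_mul_self _, ?_⟩
    simp only [Pi.add_apply, Pi.smul_apply, Finset.sum_add_distrib, ← Finset.smul_sum, sum_pullback,
      Matrix.add_kronecker, Matrix.smul_kronecker]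
  | bob I next ih =>
    refine mul_le_of_sum _ _ hg hδ (pullback_bob I next K L) ?_
      (fun c => totalTrace_nonneg (pullback_posSemidef _ _ _))
      (fun c => errorWeight_nonneg hQ (pullback_posSemidef _ _ _)) hpos hnear
      (fun c => ih c.1 _ _)
    intro c s t hs ht
    refine ⟨fun i => posSemidef_smul_add_smul (pullback_posSemidef _ _ _ _)
      (pullback_posSemidef _ _ _ _) hs ht, Kᴴ * K, s • (Lᴴ * L) +
        t • ((I.kraus c.1 c.2 * L)ᴴ * (I.kraus c.1 c.2 * L)),
        Matrix.posSemidef_conjTranspose_mul_self _,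
        posSemidef_smul_add_smul (Matrix.posSemidef_conjTranspose_mul_self _)
        (Matrix.posSemidef_conjTranspose_mul_self _) hs ht, ?_⟩
    simp only [Pi.add_apply, Pi.smul_apply, Finset.sum_add_distrib, ← Finset.smul_sum, sum_pullback,
      Matrix.kronecker_add, Matrix.kronecker_smul]

end Pullback

/-! ### Compactness of normalized product families -/

section Compactness

open scoped Matrix.Norms.Elementwise

theorem norm_le_one_of_trace_conjTranspose_mul_self {m n : Type*} [Fintype m] [Fintype n]
    {U : Matrix m n ℂ} (h : (Uᴴ * U).trace.re ≤ 1) : ‖U‖ ≤ 1 := by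
  have e : (Uᴴ * U).trace.re = ∑ j, ∑ i, ‖U i j‖ ^ 2 := by
    simp only [Matrix.trace, Matrix.diag, Matrix.mul_apply, Matrix.conjTranspose_apply,
      Complex.re_sum]
    refine Finset.sum_congr rfl fun j _ => Finset.sum_congr rfl fun i _ => ?_
    rw [← Complex.normSq_eq_norm_sq]
    simp [Complex.normSq_apply]
  rw [Matrix.norm_le_iff zero_le_one]
  intro i j
  have h1 : ‖U i j‖ ^ 2 ≤ ∑ i, ‖U i j‖ ^ 2 :=
    Finset.single_le_sum (f := fun i => ‖U i j‖ ^ 2) (fun _ _ => by positivity) (Finset.mem_univ i)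
  have h2 : ∑ i, ‖U i j‖ ^ 2 ≤ ∑ j, ∑ i, ‖U i j‖ ^ 2 :=
    Finset.single_le_sum (f := fun j => ∑ i, ‖U i j‖ ^ 2)
      (fun _ _ => Finset.sum_nonneg fun _ _ => by positivity) (Finset.mem_univ j)
  exact (sq_le_one_iff₀ (norm_nonneg _)).mp (by linarith)

theorem continuous_kronecker {T l m n p : Type*} [TopologicalSpace T] {A : T → Matrix l m ℂ}
    {B : T → Matrix n p ℂ} (hA : Continuous A) (hB : Continuous B) :
    Continuous fun t => A t ⊗ₖ B t :=
  continuous_matrix fun i j => (hA.matrix_elem i.1 j.1).mul (hB.matrix_elem i.2 j.2)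

/-- If the error does not vanish on normalized product families at distance `χ` from `C`, it is
bounded below there. -/
theorem exists_errorWeight_lower_bound {ι : Type} [Fintype ι] {dA dB : ℕ}
    (Q : ι → BipOp dA dB) (C : BipOp dA dB) (χ : ℝ)
    (h : ∀ X ∈ productFamilies ι dA dB, totalTrace ι dA dB X = 1 → ‖∑ i, X i - C‖ = χ →
      0 < errorWeight Q X) :
    ∃ δ > 0, ∀ X ∈ productFamilies ι dA dB, totalTrace ι dA dB X = 1 → ‖∑ i, X i - C‖ = χ →
      δ ≤ errorWeight Q X := by
  -- Parametrizing positive operators by factors `Uᴴ * U` makes the constraints closed equations,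
  -- and the unit traces bound all the factors.
  let S : Set (Matrix (Fin dA) (Fin dA) ℂ × Matrix (Fin dB) (Fin dB) ℂ × (ι → BipOp dA dB)) :=
    {p | (p.1ᴴ * p.1).trace = 1 ∧ (p.2.1ᴴ * p.2.1).trace = 1 ∧
      ∑ i, (p.2.2 i)ᴴ * p.2.2 i = (p.1ᴴ * p.1) ⊗ₖ (p.2.1ᴴ * p.2.1) ∧
      ‖∑ i, (p.2.2 i)ᴴ * p.2.2 i - C‖ = χ}
  have hc1 : Continuous fun p : Matrix (Fin dA) (Fin dA) ℂ × Matrix (Fin dB) (Fin dB) ℂ ×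
      (ι → BipOp dA dB) => p.1ᴴ * p.1 :=
    continuous_fst.matrix_conjTranspose.matrix_mul continuous_fst
  have hc2 : Continuous fun p : Matrix (Fin dA) (Fin dA) ℂ × Matrix (Fin dB) (Fin dB) ℂ ×
      (ι → BipOp dA dB) => p.2.1ᴴ * p.2.1 := by
    have : Continuous fun p : Matrix (Fin dA) (Fin dA) ℂ × Matrix (Fin dB) (Fin dB) ℂ ×
      (ι → BipOp dA dB) => p.2.1 := by fun_prop
    exact this.matrix_conjTranspose.matrix_mul this
  have hc3 : ∀ i, Continuous fun p : Matrix (Fin dA) (Fin dA) ℂ × Matrix (Fin dB) (Fin dB) ℂ ×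
      (ι → BipOp dA dB) => (p.2.2 i)ᴴ * p.2.2 i := by
    intro i
    have : Continuous fun p : Matrix (Fin dA) (Fin dA) ℂ × Matrix (Fin dB) (Fin dB) ℂ ×
      (ι → BipOp dA dB) => p.2.2 i := by fun_prop
    exact this.matrix_conjTranspose.matrix_mul this
  have hc4 := continuous_finsetSum Finset.univ fun i _ => hc3 i
  have hclosed : IsClosed S := by
    refine (isClosed_eq hc1.matrix_trace continuous_const).inter
      ((isClosed_eq hc2.matrix_trace continuous_const).inter
      ((isClosed_eq hc4 (continuous_kronecker hc1 hc2)).inter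
      (isClosed_eq (hc4.sub continuous_const).norm continuous_const)))
  have hbdd : S ⊆ Metric.closedBall 0 1 := by
    rintro ⟨U, W, V⟩ ⟨h1, h2, h3, -⟩
    simp only at h1 h2 h3
    rw [mem_closedBall_zero_iff, norm_prod_le_iff, norm_prod_le_iff, pi_norm_le_iff_of_nonneg zero_le_one]
    refine ⟨norm_le_one_of_trace_conjTranspose_mul_self (by simp [h1]),
      norm_le_one_of_trace_conjTranspose_mul_self (by simp [h2]), fun i =>
      norm_le_one_of_trace_conjTranspose_mul_self ?_⟩
    have h4 := congrArg (fun X => X.trace.re) h3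
    simp only [Matrix.trace_kronecker, h1, h2, Matrix.trace_sum, Complex.re_sum, mul_one,
      Complex.one_re] at h4
    rw [← h4]
    exact Finset.single_le_sum (f := fun i => ((V i)ᴴ * V i).trace.re) (fun i _ =>
      (Complex.le_def.mp (Matrix.posSemidef_conjTranspose_mul_self (V i)).trace_nonneg).1)
      (Finset.mem_univ i)
  have : ProperSpace (Matrix (Fin dA) (Fin dA) ℂ × Matrix (Fin dB) (Fin dB) ℂ ×
      (ι → BipOp dA dB)) := FiniteDimensional.proper ℂ _
  have hcomp : IsCompact S := (isCompact_closedBall _ _).of_isClosed_subset hclosed hbdd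
  have hcont : Continuous fun p : Matrix (Fin dA) (Fin dA) ℂ × Matrix (Fin dB) (Fin dB) ℂ ×
      (ι → BipOp dA dB) => errorWeight Q fun i => (p.2.2 i)ᴴ * p.2.2 i := by
    simp only [errorWeight_apply]
    exact continuous_finsetSum _ fun i _ => Complex.continuous_re.comp
      ((hc3 i).matrix_mul continuous_const).matrix_trace
  obtain ⟨δ, hδ, hle⟩ := hcomp.exists_forall_le' hcont.continuousOn (a := 0) (by
    rintro ⟨U, W, V⟩ ⟨h1, h2, h3, h4⟩
    simp only at h1 h2 h3 h4
    refine h _ ⟨fun i => Matrix.posSemidef_conjTranspose_mul_self _, Uᴴ * U, Wᴴ * W,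
      Matrix.posSemidef_conjTranspose_mul_self _, Matrix.posSemidef_conjTranspose_mul_self _, h3⟩
      ?_ h4
    rw [totalTrace_apply, h3, Matrix.trace_kronecker, h1, h2]
    simp)
  refine ⟨δ, hδ, ?_⟩
  rintro X ⟨hX, A, B, hA, hB, hAB⟩ htr hχ
  rw [totalTrace_apply, hAB, Matrix.trace_kronecker] at htr
  have eA : (A.trace.re : ℂ) = A.trace := by
    apply Complex.ext <;> simp [← (Complex.le_def.mp hA.trace_nonneg).2]
  have eB : (B.trace.re : ℂ) = B.trace := by
    apply Complex.ext <;> simp [← (Complex.le_def.mp hB.trace_nonneg).2]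
  rw [← eA, ← eB, ← Complex.ofReal_mul, Complex.ofReal_re] at htr
  have hA0 : 0 ≤ A.trace.re := (Complex.le_def.mp hA.trace_nonneg).1
  have hB0 : 0 ≤ B.trace.re := (Complex.le_def.mp hB.trace_nonneg).1
  -- Since the traces of `A` and `B` multiply to one, scaling each by the trace of the other
  -- normalizes both and leaves `A ⊗ₖ B` unchanged.
  obtain ⟨U, hU⟩ := exists_eq_conjTranspose_mul_self (hA.smul hB0)
  obtain ⟨W, hW⟩ := exists_eq_conjTranspose_mul_self (hB.smul hA0)
  choose V hV using fun i => exists_eq_conjTranspose_mul_self (hX i)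
  have key := hle (U, W, V) ⟨by
    simp only
    rw [← hU, Matrix.trace_smul, ← eA, Complex.real_smul, ← Complex.ofReal_mul, mul_comm, htr]
    simp, by
    simp only
    rw [← hW, Matrix.trace_smul, ← eB, Complex.real_smul, ← Complex.ofReal_mul, htr]
    simp, by
    simp only [← hV]
    rw [hAB, ← hU, ← hW, Matrix.smul_kronecker, Matrix.kronecker_smul, smul_smul, mul_comm, htr,
      one_smul], by
    simp only [← hV]
    exact hχ⟩
  simpa only [← hV] using key

end Compactness

/-! ### Projective measurements -/

/-- Orthogonal projectors onto mutually orthogonal subspaces that span the space. -/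
structure IsProjective {ι n : Type*} [Fintype ι] [Fintype n] [DecidableEq n]
    (Q : ι → Matrix n n ℂ) : Prop where
  conjTranspose_eq : ∀ i, (Q i)ᴴ = Q i
  mul_self : ∀ i, Q i * Q i = Q i
  mul_eq_zero : ∀ i j, i ≠ j → Q i * Q j = 0
  sum_eq : ∑ i, Q i = 1

namespace IsProjective

variable {ι n : Type*} [Fintype ι] [Fintype n] [DecidableEq n] {Q : ι → Matrix n n ℂ}

theorem posSemidef (hQ : IsProjective Q) (i : ι) : (Q i).PosSemidef := by
  have := Matrix.posSemidef_conjTranspose_mul_self (Q i)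
  rwa [hQ.conjTranspose_eq, hQ.mul_self] at this

theorem one_sub_posSemidef (hQ : IsProjective Q) (i : ι) : (1 - Q i).PosSemidef := by
  have := Matrix.posSemidef_conjTranspose_mul_self (1 - Q i)
  rwa [Matrix.conjTranspose_sub, hQ.conjTranspose_eq, Matrix.conjTranspose_one, Matrix.sub_mul,
    Matrix.one_mul, Matrix.mul_sub, hQ.mul_self, Matrix.mul_one, sub_self, sub_zero] at this

/-- A sum of positive operators, each supported in one of the subspaces, commutes with the
projectors. -/
theorem commute_sum (hQ : IsProjective Q) {X : ι → Matrix n n ℂ} (hX : ∀ i, (X i).PosSemidef)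
    (h : ∀ i, (X i * (1 - Q i)).trace = 0) (j : ι) : (∑ i, X i) * Q j = Q j * ∑ i, X i := by
  have h1 : ∀ i, X i * Q i = X i := by
    intro i
    have := mul_eq_zero_of_trace_mul_eq_zero (hX i) (hQ.one_sub_posSemidef i) (h i)
    rw [Matrix.mul_sub, Matrix.mul_one, sub_eq_zero] at this
    exact this.symm
  have h2 : ∀ i, Q i * X i = X i := by
    intro i
    have := congrArg Matrix.conjTranspose (h1 i)
    rwa [Matrix.conjTranspose_mul, hQ.conjTranspose_eq, (hX i).1.eq] at this
  rw [Matrix.sum_mul, Matrix.mul_sum]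
  refine Finset.sum_congr rfl fun i _ => ?_
  by_cases hij : i = j
  · rw [hij, h1, h2]
  · rw [← h1 i, Matrix.mul_assoc, hQ.mul_eq_zero i j hij, h1, ← h2 i, ← Matrix.mul_assoc,
      hQ.mul_eq_zero j i (Ne.symm hij), Matrix.mul_zero, Matrix.zero_mul]

/-- The restriction of projectors to an invariant subspace. -/
theorem compress (hQ : IsProjective Q) {m : Type*} [Fintype m] [DecidableEq m] {W : Matrix n m ℂ}
    (hW : Wᴴ * W = 1) (hc : ∀ i, W * Wᴴ * Q i = Q i * (W * Wᴴ)) :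
    IsProjective fun i => Wᴴ * Q i * W := by
  have key : ∀ i j, Wᴴ * Q i * W * (Wᴴ * Q j * W) = Wᴴ * (Q i * Q j) * W := by
    intro i j
    calc Wᴴ * Q i * W * (Wᴴ * Q j * W) = Wᴴ * (Q i * (W * Wᴴ)) * Q j * W := by
          simp only [Matrix.mul_assoc]
      _ = (Wᴴ * W) * Wᴴ * (Q i * Q j) * W := by rw [← hc]; simp only [Matrix.mul_assoc]
      _ = _ := by rw [hW, Matrix.one_mul]
  refine ⟨fun i => ?_, fun i => ?_, fun i j hij => ?_, ?_⟩
  · simp [Matrix.conjTranspose_mul, hQ.conjTranspose_eq, Matrix.mul_assoc]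
  · rw [key, hQ.mul_self]
  · rw [key, hQ.mul_eq_zero i j hij, Matrix.mul_zero, Matrix.zero_mul]
  · rw [← Matrix.sum_mul, ← Matrix.mul_sum, hQ.sum_eq, Matrix.mul_one, hW]

end IsProjective

/-! ### A product operator commuting with the measurement -/

section Existence

open scoped Matrix.Norms.Elementwise

theorem re_trace_pos {n : Type*} [Fintype n] [DecidableEq n] {A : Matrix n n ℂ} (hA : A.PosSemidef)
    (h : A ≠ 0) : 0 < A.trace.re := by
  have h1 := Complex.le_def.mp hA.trace_nonneg
  refine lt_of_le_of_ne h1.1 fun h0 => h (hA.trace_eq_zero_iff.mp ?_)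
  exact Complex.ext h0.symm h1.2.symm

/-- If a nontrivial projective measurement is in asymptotic LOCC, then a product operator that is
not scalar, and not orthogonal to any of the projectors, commutes with the measurement. -/
theorem exists_commuting_product {ι : Type} [Fintype ι] [DecidableEq ι] {dA dB : ℕ}
    {Q : ι → BipOp dA dB} (hQ : IsProjective Q) (hne : ∀ i, Q i ≠ 1) (hnon : Nonempty ι)
    (hasymp : IsAsymptoticLOCC Q) :
    ∃ (A : Matrix (Fin dA) (Fin dA) ℂ) (B : Matrix (Fin dB) (Fin dB) ℂ),
      A.PosSemidef ∧ B.PosSemidef ∧ (∀ a b : ℂ, ¬ (A = a • 1 ∧ B = b • 1)) ∧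
      (∀ i, (A ⊗ₖ B) * Q i = Q i * (A ⊗ₖ B)) ∧ ∀ i, Q i ≠ 0 → ((A ⊗ₖ B) * Q i).trace ≠ 0 := by
  obtain ⟨i₁⟩ := hnon
  have hD : 0 < (dA * dB : ℝ) := by
    by_contra! h0
    have : (dA : ℝ) * dB = 0 := le_antisymm h0 (by positivity)
    have : IsEmpty (Fin dA × Fin dB) := by
      rw [← Fintype.card_eq_zero_iff]
      simpa using this
    exact hne i₁ (Subsingleton.elim _ _)
  set D : ℝ := dA * dB with hDdef
  set C : BipOp dA dB := D⁻¹ • 1 with hC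
  have htr1 : (1 : BipOp dA dB).trace.re = D := by simp [Matrix.trace_one, hDdef]
  -- No projector is the identity, so every declaration made at the center `C` has positive error.
  obtain ⟨c, hc, hcle⟩ : ∃ c > 0, ∀ i, c < (C * (1 - Q i)).trace.re := by
    have hp : ∀ i, 0 < (C * (1 - Q i)).trace.re := by
      intro i
      have := re_trace_pos (hQ.one_sub_posSemidef i) (sub_ne_zero.mpr (hne i).symm)
      rw [hC, Matrix.smul_mul, Matrix.one_mul, Matrix.trace_smul, Complex.smul_re, smul_eq_mul]
      positivity
    obtain ⟨j, -, hj⟩ := Finset.exists_min_image Finset.univ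
      (fun i => (C * (1 - Q i)).trace.re) ⟨i₁, Finset.mem_univ _⟩
    exact ⟨_, half_pos (hp j), fun i => (half_lt_self (hp j)).trans_le (hj i (Finset.mem_univ i))⟩
  have hcont : ∀ R : BipOp dA dB, Continuous fun X : BipOp dA dB => (X * R).trace.re := fun R =>
    Complex.continuous_re.comp (continuous_id.matrix_mul continuous_const).matrix_trace
  have hev : ∀ᶠ X in nhds C, ∀ i, c < (X * (1 - Q i)).trace.re ∧
      (Q i ≠ 0 → 0 < (X * Q i).trace.re) := by
    rw [Filter.eventually_all]
    intro i
    refine ((hcont _).continuousAt.eventually_const_lt (hcle i)).and ?_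
    by_cases h0 : Q i = 0
    · simp [h0]
    · have : 0 < (C * Q i).trace.re := by
        have := re_trace_pos (hQ.posSemidef i) h0
        rw [hC, Matrix.smul_mul, Matrix.one_mul, Matrix.trace_smul, Complex.smul_re, smul_eq_mul]
        positivity
      filter_upwards [(hcont _).continuousAt.eventually_const_lt this] with X hX _ using hX
  obtain ⟨ε, hε, hball⟩ := Metric.eventually_nhds_iff_ball.mp hev
  simp only [mem_ball_iff_norm] at hball
  -- Radius `ε / 2` keeps the sphere itself inside the open ball where both estimates of `hball`
  -- hold.
  have hχ : 0 < ε / 2 := half_pos hε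
  by_contra hcon
  have hpos : ∀ X ∈ productFamilies ι dA dB, totalTrace ι dA dB X = 1 → ‖∑ i, X i - C‖ = ε / 2 →
      0 < errorWeight Q X := by
    rintro X ⟨hX, A, B, hA, hB, hAB⟩ htr hdist
    -- A zero-error family on the sphere would provide the `A` and `B` excluded by `hcon`.
    refine lt_of_le_of_ne (errorWeight_nonneg hQ.one_sub_posSemidef hX) fun h0 => hcon ?_
    have hzero : ∀ i, (X i * (1 - Q i)).trace = 0 := by
      intro i
      have hnn := fun i => Complex.le_def.mp (trace_mul_nonneg (hX i) (hQ.one_sub_posSemidef i))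
      rw [errorWeight_apply, eq_comm, Finset.sum_eq_zero_iff_of_nonneg fun i _ => (hnn i).1] at h0
      exact Complex.ext (h0 i (Finset.mem_univ i)) (hnn i).2.symm
    refine ⟨A, B, hA, hB, ?_, fun i => ?_, fun i hi h => ?_⟩
    -- A scalar product of trace one is `C` itself, at distance zero rather than `ε / 2`.
    · rintro a b ⟨rfl, rfl⟩
      rw [totalTrace_apply, hAB] at htr
      rw [hAB] at hdist
      have hs : (a • (1 : Matrix (Fin dA) (Fin dA) ℂ)) ⊗ₖ (b • (1 : Matrix (Fin dB) (Fin dB) ℂ)) =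
          (a * b) • (1 : BipOp dA dB) := by
        rw [Matrix.smul_kronecker, Matrix.kronecker_smul, Matrix.one_kronecker_one, smul_smul]
      have hps := hA.kronecker hB
      rw [hs] at hps hdist htr
      have him := (Complex.le_def.mp hps.trace_nonneg).2
      have htrc : ((a * b) • (1 : BipOp dA dB)).trace = 1 := Complex.ext htr him.symm
      have h1 : (1 : BipOp dA dB).trace = (D : ℂ) := by simp [Matrix.trace_one, hDdef]
      rw [Matrix.trace_smul, h1, smul_eq_mul] at htrc
      have : a * b = ((D⁻¹ : ℝ) : ℂ) := by
        rw [Complex.ofReal_inv]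
        exact eq_inv_of_mul_eq_one_left htrc
      rw [this, hC, Complex.coe_smul, sub_self, norm_zero] at hdist
      linarith
    · rw [← hAB]
      exact hQ.commute_sum hX hzero i
    · have := (hball (∑ i, X i) (by rw [hdist]; linarith) i).2 hi
      rw [hAB, h] at this
      simp at this
  obtain ⟨δ, hδ, hδle⟩ := exists_errorWeight_lower_bound Q C (ε / 2) hpos
  obtain ⟨P, hP⟩ := hasymp
  have hbound : ∀ t, min δ c * D ≤ errorWeight Q (P t).povm := by
    intro t
    have hpb : pullback (P t) (1 : Matrix (Fin dA) (Fin dA) ℂ) (1 : Matrix (Fin dB) (Fin dB) ℂ) =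
        (P t).povm := by
      ext1 i
      simp [pullback]
    have htt : totalTrace ι dA dB (P t).povm = D := by
      rw [totalTrace_apply, sum_povm, htr1]
    -- At the root `K = L = 1`, and the normalized effect is exactly the center `C`.
    have := mul_totalTrace_le_errorWeight hQ.one_sub_posSemidef (δ := min δ c) (χ := ε / 2) (C := C)
      (fun X h1 h2 h3 => (min_le_left _ _).trans (hδle X h1 h2 h3))
      (fun E hE i => (min_le_right _ _).trans (hball E (hE.trans (half_lt_self hε)) i).1.le)
      (P t) 1 1 (by rw [hpb, htt]; exact hD) (by
        rw [hpb, htt]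
        simp only [Pi.smul_apply, ← Finset.smul_sum]
        rw [sum_povm, hC, sub_self, norm_zero]
        exact hχ)
    rwa [hpb, htt] at this
  have herr : Continuous fun X : ι → BipOp dA dB => errorWeight Q X := by
    simp only [errorWeight_apply]
    exact continuous_finsetSum _ fun i _ => (hcont _).comp (continuous_apply i)
  have hlim := ge_of_tendsto' ((herr.tendsto Q).comp hP) hbound
  have hQ0 : errorWeight Q Q = 0 := by
    rw [errorWeight_apply]
    exact Finset.sum_eq_zero fun i _ => by simp [Matrix.mul_sub, hQ.mul_self]
  rw [hQ0] at hlim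
  have : 0 < min δ c * D := mul_pos (lt_min hδ hc) hD
  linarith

end Existence

/-! ### Splitting a measurement by a local projective measurement -/

section Splitting

/-- If a product operator commutes with a product `a ⊗ b` and is not orthogonal to it, then its
factors commute with `a` and `b`. -/
theorem commute_of_commute_kronecker {m n : Type*} [Fintype m] [Fintype n]
    {A a : Matrix m m ℂ} {B b : Matrix n n ℂ}
    (h : (A ⊗ₖ B) * (a ⊗ₖ b) = (a ⊗ₖ b) * (A ⊗ₖ B)) (h0 : ((A ⊗ₖ B) * (a ⊗ₖ b)).trace ≠ 0) :
    A * a = a * A ∧ B * b = b * B := by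
  rw [← Matrix.mul_kronecker_mul, Matrix.trace_kronecker] at h0
  rw [← Matrix.mul_kronecker_mul, ← Matrix.mul_kronecker_mul] at h
  have hA0 := left_ne_zero_of_mul h0
  have hB0 := right_ne_zero_of_mul h0
  constructor
  · ext i j
    -- Take the partial trace over the second factor; the traces of `B * b` and `b * B` agree and
    -- are nonzero, so they cancel.
    have h1 : ∑ x, ((A * a) ⊗ₖ (B * b)) (i, x) (j, x) = ∑ x, ((a * A) ⊗ₖ (b * B)) (i, x) (j, x) := by
      rw [h]
    simp only [Matrix.kronecker_apply, ← Finset.mul_sum] at h1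
    change (A * a) i j * (B * b).trace = (a * A) i j * (b * B).trace at h1
    rw [Matrix.trace_mul_comm b B] at h1
    exact mul_right_cancel₀ hB0 h1
  · ext i j
    have h1 : ∑ x, ((A * a) ⊗ₖ (B * b)) (x, i) (x, j) = ∑ x, ((a * A) ⊗ₖ (b * B)) (x, i) (x, j) := by
      rw [h]
    simp only [Matrix.kronecker_apply, ← Finset.sum_mul] at h1
    change (A * a).trace * (B * b) i j = (a * A).trace * (b * B) i j at h1
    rw [Matrix.trace_mul_comm a A] at h1
    exact mul_left_cancel₀ hA0 h1

theorem tendsto_compress {ι m n : Type*} [Fintype m] {M : ℕ → ι → Matrix m m ℂ}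
    {N : ι → Matrix m m ℂ} (h : Filter.Tendsto M Filter.atTop (nhds N)) (W : Matrix m n ℂ) :
    Filter.Tendsto (fun t i => Wᴴ * M t i * W) Filter.atTop (nhds fun i => Wᴴ * N i * W) := by
  have hc : Continuous fun (X : ι → Matrix m m ℂ) i => Wᴴ * X i * W :=
    continuous_pi fun i => (continuous_const.matrix_mul (continuous_apply i)).matrix_mul
      continuous_const
  exact (hc.tendsto N).comp h

variable {ι : Type} [DecidableEq ι] {dA dB : ℕ} {Q : ι → BipOp dA dB}

/-- An isometry is an instrument with one outcome: Alice embeds the smaller space by `V`, then the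
original protocols run. -/
theorem IsAsymptoticLOCC.compress_left (h : IsAsymptoticLOCC Q) {m : ℕ}
    {V : Matrix (Fin dA) (Fin m) ℂ} (hV : Vᴴ * V = 1) :
    IsAsymptoticLOCC fun i => (V ⊗ₖ (1 : Matrix (Fin dB) (Fin dB) ℂ))ᴴ *
      Q i * (V ⊗ₖ (1 : Matrix (Fin dB) (Fin dB) ℂ)) := by
  obtain ⟨P, hP⟩ := h
  refine ⟨fun t => .alice ⟨1, fun _ => dA, fun _ => 1, fun _ _ => V, by simpa using hV⟩
    fun _ => P t, ?_⟩
  convert tendsto_compress hP (V ⊗ₖ (1 : Matrix (Fin dB) (Fin dB) ℂ)) using 2 with t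
  ext1 i
  simp [Protocol.povm]

theorem IsAsymptoticLOCC.compress_right (h : IsAsymptoticLOCC Q) {m : ℕ}
    {V : Matrix (Fin dB) (Fin m) ℂ} (hV : Vᴴ * V = 1) :
    IsAsymptoticLOCC fun i => ((1 : Matrix (Fin dA) (Fin dA) ℂ) ⊗ₖ V)ᴴ *
      Q i * ((1 : Matrix (Fin dA) (Fin dA) ℂ) ⊗ₖ V) := by
  obtain ⟨P, hP⟩ := h
  refine ⟨fun t => .bob ⟨1, fun _ => dB, fun _ => 1, fun _ _ => V, by simpa using hV⟩
    fun _ => P t, ?_⟩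
  convert tendsto_compress hP ((1 : Matrix (Fin dA) (Fin dA) ℂ) ⊗ₖ V) using 2 with t
  ext1 i
  simp [Protocol.povm]

/-- Commuting with the block projectors makes `q` block diagonal, so its diagonal blocks recover it.
-/
theorem sum_compress {κ n : Type*} [Fintype κ] [Fintype n] [DecidableEq n] {m : κ → Type*}
    [∀ k, Fintype (m k)] [∀ k, DecidableEq (m k)] {W : (k : κ) → Matrix n (m k) ℂ}
    (hW : ∀ k, (W k)ᴴ * W k = 1) (hs : ∑ k, W k * (W k)ᴴ = 1) {q : Matrix n n ℂ}
    (hc : ∀ k, W k * (W k)ᴴ * q = q * (W k * (W k)ᴴ)) :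
    ∑ k, W k * ((W k)ᴴ * q * W k) * (W k)ᴴ = q := by
  calc ∑ k, W k * ((W k)ᴴ * q * W k) * (W k)ᴴ = ∑ k, q * (W k * (W k)ᴴ) := by
        refine Finset.sum_congr rfl fun k _ => ?_
        calc W k * ((W k)ᴴ * q * W k) * (W k)ᴴ = (W k * (W k)ᴴ * q) * (W k * (W k)ᴴ) := by
              simp only [Matrix.mul_assoc]
          _ = q * (W k * ((W k)ᴴ * W k) * (W k)ᴴ) := by rw [hc]; simp only [Matrix.mul_assoc]
          _ = _ := by rw [hW, Matrix.mul_one]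
    _ = q := by rw [← Matrix.mul_sum, hs, Matrix.mul_one]

/-- Alice measures with Kraus operators `(V k)ᴴ`; outcome `k` leaves her in the smaller space, where
the compressed measurement is carried out. -/
theorem IsFiniteLOCC.of_compress_left {r : ℕ} {m : Fin r → ℕ}
    {V : (k : Fin r) → Matrix (Fin dA) (Fin (m k)) ℂ} (hV : ∀ k, (V k)ᴴ * V k = 1)
    (hs : ∑ k, V k * (V k)ᴴ = 1)
    (hc : ∀ k i, (V k ⊗ₖ (1 : Matrix (Fin dB) (Fin dB) ℂ)) * (V k ⊗ₖ (1 : Matrix (Fin dB) (Fin dB) ℂ))ᴴ * Q i =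
      Q i * ((V k ⊗ₖ (1 : Matrix (Fin dB) (Fin dB) ℂ)) * (V k ⊗ₖ (1 : Matrix (Fin dB) (Fin dB) ℂ))ᴴ))
    (h : ∀ k, IsFiniteLOCC fun i =>
      (V k ⊗ₖ (1 : Matrix (Fin dB) (Fin dB) ℂ))ᴴ * Q i * (V k ⊗ₖ (1 : Matrix (Fin dB) (Fin dB) ℂ))) : IsFiniteLOCC Q := by
  choose P hP using h
  refine ⟨.alice ⟨r, m, fun _ => 1, fun k _ => (V k)ᴴ, by simpa using hs⟩ P, ?_⟩
  ext1 i
  simp only [Protocol.povm, hP]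
  conv_rhs => rw [← sum_compress (W := fun k => V k ⊗ₖ (1 : Matrix (Fin dB) (Fin dB) ℂ))
    (fun k => by rw [Matrix.conjTranspose_kronecker, ← Matrix.mul_kronecker_mul, hV]; simp)
    (by
      simp only [Matrix.conjTranspose_kronecker, ← Matrix.mul_kronecker_mul]
      ext x y
      have := congrFun (congrFun hs x.1) y.1
      simp only [Matrix.sum_apply] at this
      rw [← Matrix.one_kronecker_one]
      simp only [Matrix.sum_apply, Matrix.kroneckerMap_apply, ← Finset.sum_mul, this,
        Matrix.mul_one, Matrix.conjTranspose_one])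
    (fun k => hc k i)]
  refine Finset.sum_congr rfl fun k _ => ?_
  simp [Matrix.conjTranspose_kronecker]

theorem IsFiniteLOCC.of_compress_right {r : ℕ} {m : Fin r → ℕ}
    {V : (k : Fin r) → Matrix (Fin dB) (Fin (m k)) ℂ} (hV : ∀ k, (V k)ᴴ * V k = 1)
    (hs : ∑ k, V k * (V k)ᴴ = 1)
    (hc : ∀ k i, ((1 : Matrix (Fin dA) (Fin dA) ℂ) ⊗ₖ V k) * ((1 : Matrix (Fin dA) (Fin dA) ℂ) ⊗ₖ V k)ᴴ * Q i =
      Q i * (((1 : Matrix (Fin dA) (Fin dA) ℂ) ⊗ₖ V k) * ((1 : Matrix (Fin dA) (Fin dA) ℂ) ⊗ₖ V k)ᴴ))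
    (h : ∀ k, IsFiniteLOCC fun i =>
      ((1 : Matrix (Fin dA) (Fin dA) ℂ) ⊗ₖ V k)ᴴ * Q i *
        ((1 : Matrix (Fin dA) (Fin dA) ℂ) ⊗ₖ V k)) : IsFiniteLOCC Q := by
  choose P hP using h
  refine ⟨.bob ⟨r, m, fun _ => 1, fun k _ => (V k)ᴴ, by simpa using hs⟩ P, ?_⟩
  ext1 i
  simp only [Protocol.povm, hP]
  conv_rhs => rw [← sum_compress (W := fun k => (1 : Matrix (Fin dA) (Fin dA) ℂ) ⊗ₖ V k)
    (fun k => by rw [Matrix.conjTranspose_kronecker, ← Matrix.mul_kronecker_mul, hV]; simp)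
    (by
      simp only [Matrix.conjTranspose_kronecker, ← Matrix.mul_kronecker_mul]
      ext x y
      have := congrFun (congrFun hs x.2) y.2
      simp only [Matrix.sum_apply] at this
      rw [← Matrix.one_kronecker_one]
      simp only [Matrix.sum_apply, Matrix.kroneckerMap_apply, ← Finset.mul_sum, this,
        Matrix.mul_one, Matrix.conjTranspose_one])
    (fun k => hc k i)]
  refine Finset.sum_congr rfl fun k _ => ?_
  simp [Matrix.conjTranspose_kronecker]

end Splitting

/-! ### The induction on dimension -/

theorem IsProjective.commute_of_ne {ι n : Type*} [Fintype ι] [DecidableEq ι] [Fintype n]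
    [DecidableEq n] {Q : ι → Matrix n n ℂ} (hQ : IsProjective Q) {R : Matrix n n ℂ} {i₀ : ι}
    (h : ∀ i, i ≠ i₀ → R * Q i = Q i * R) (i : ι) : R * Q i = Q i * R := by
  by_cases hi : i = i₀
  -- The exceptional projector is the complement of the others, so it needs no product structure.
  · have hs : Q i₀ = 1 - ∑ j ∈ Finset.univ.erase i₀, Q j := by
      rw [← hQ.sum_eq, ← Finset.add_sum_erase _ _ (Finset.mem_univ i₀), add_sub_cancel_right]
    rw [hi, hs, Matrix.mul_sub, Matrix.sub_mul, Matrix.mul_sum, Matrix.sum_mul, Matrix.mul_one,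
      Matrix.one_mul]
    congr 1
    exact Finset.sum_congr rfl fun j hj => h j (Finset.ne_of_mem_erase hj)
  · exact h i hi

/-- A projective measurement in asymptotic LOCC, all of whose projectors but one are products, is in
finite LOCC. -/
theorem IsAsymptoticLOCC.isFiniteLOCC {ι : Type} [Fintype ι] [DecidableEq ι] {dA dB : ℕ}
    {Q : ι → BipOp dA dB} (hQ : IsProjective Q) (i₀ : ι)
    (hprod : ∀ i, i ≠ i₀ → ∃ (a : Matrix (Fin dA) (Fin dA) ℂ) (b : Matrix (Fin dB) (Fin dB) ℂ),
      Q i = a ⊗ₖ b)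
    (hasymp : IsAsymptoticLOCC Q) : IsFiniteLOCC Q := by
  induction hN : dA + dB using Nat.strong_induction_on generalizing dA dB with
  | _ N ih =>
  subst hN
  by_cases hone : ∃ i, Q i = 1
  · obtain ⟨i, hi⟩ := hone
    refine ⟨.declare i, ?_⟩
    ext1 j
    simp only [Protocol.povm]
    split_ifs with hij
    · rw [hij, hi]
    · rw [← hQ.mul_eq_zero j i hij, hi, Matrix.mul_one]
  push Not at hone
  obtain ⟨A, B, hA, hB, hns, hcomm, htr⟩ := exists_commuting_product hQ hone ⟨i₀⟩ hasymp
  -- Zero projectors are set apart because the nonzero trace needed to separate the factors is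
  -- available only for nonzero ones.
  have hfac : ∀ i, i ≠ i₀ → Q i = 0 ∨
      ∃ (a : Matrix (Fin dA) (Fin dA) ℂ) (b : Matrix (Fin dB) (Fin dB) ℂ),
        Q i = a ⊗ₖ b ∧ A * a = a * A ∧ B * b = b * B := by
    intro i hi
    by_cases h0 : Q i = 0
    · exact Or.inl h0
    · obtain ⟨a, b, hab⟩ := hprod i hi
      have h1 := hcomm i
      have h2 := htr i h0
      rw [hab] at h1 h2
      exact Or.inr ⟨a, b, hab, commute_of_commute_kronecker h1 h2⟩
  -- Not both factors are scalar; a party holding a non-scalar one measures its spectral splitting,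
  -- lowering that party's dimension.
  by_cases hAs : ∃ c : ℂ, A = c • 1
  · obtain ⟨c, hc⟩ := hAs
    obtain ⟨m, V, hm, hV, hs, hVc⟩ :=
      exists_isometries_of_not_scalar hB.1 fun b hb => hns c b ⟨hc, hb⟩
    have hcV : ∀ k i, ((1 : Matrix (Fin dA) (Fin dA) ℂ) ⊗ₖ V k) *
        ((1 : Matrix (Fin dA) (Fin dA) ℂ) ⊗ₖ V k)ᴴ * Q i =
        Q i * (((1 : Matrix (Fin dA) (Fin dA) ℂ) ⊗ₖ V k) *
          ((1 : Matrix (Fin dA) (Fin dA) ℂ) ⊗ₖ V k)ᴴ) := by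
      intro k
      refine hQ.commute_of_ne (i₀ := i₀) fun i hi => ?_
      rcases hfac i hi with h0 | ⟨a, b, hab, -, hb⟩
      · rw [h0, Matrix.mul_zero, Matrix.zero_mul]
      · rw [hab, Matrix.conjTranspose_kronecker, ← Matrix.mul_kronecker_mul,
          ← Matrix.mul_kronecker_mul, ← Matrix.mul_kronecker_mul, hVc k b hb]
        simp
    refine IsFiniteLOCC.of_compress_right hV hs hcV fun k => ?_
    refine ih (dA + m k) (by have := hm k; omega) (hQ.compress ?_ (hcV k)) ?_
      (hasymp.compress_right (hV k)) rfl
    · rw [Matrix.conjTranspose_kronecker, ← Matrix.mul_kronecker_mul, hV]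
      simp
    · intro i hi
      obtain ⟨a, b, hab⟩ := hprod i hi
      refine ⟨a, (V k)ᴴ * b * V k, ?_⟩
      rw [hab, Matrix.conjTranspose_kronecker, ← Matrix.mul_kronecker_mul,
        ← Matrix.mul_kronecker_mul]
      simp
  · push Not at hAs
    obtain ⟨m, V, hm, hV, hs, hVc⟩ := exists_isometries_of_not_scalar hA.1 hAs
    have hcV : ∀ k i, (V k ⊗ₖ (1 : Matrix (Fin dB) (Fin dB) ℂ)) *
        (V k ⊗ₖ (1 : Matrix (Fin dB) (Fin dB) ℂ))ᴴ * Q i =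
        Q i * ((V k ⊗ₖ (1 : Matrix (Fin dB) (Fin dB) ℂ)) *
          (V k ⊗ₖ (1 : Matrix (Fin dB) (Fin dB) ℂ))ᴴ) := by
      intro k
      refine hQ.commute_of_ne (i₀ := i₀) fun i hi => ?_
      rcases hfac i hi with h0 | ⟨a, b, hab, ha, -⟩
      · rw [h0, Matrix.mul_zero, Matrix.zero_mul]
      · rw [hab, Matrix.conjTranspose_kronecker, ← Matrix.mul_kronecker_mul,
          ← Matrix.mul_kronecker_mul, ← Matrix.mul_kronecker_mul, hVc k a ha]
        simp
    refine IsFiniteLOCC.of_compress_left hV hs hcV fun k => ?_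
    refine ih (m k + dB) (by have := hm k; omega) (hQ.compress ?_ (hcV k)) ?_
      (hasymp.compress_left (hV k)) rfl
    · rw [Matrix.conjTranspose_kronecker, ← Matrix.mul_kronecker_mul, hV]
      simp
    · intro i hi
      obtain ⟨a, b, hab⟩ := hprod i hi
      refine ⟨(V k)ᴴ * a * V k, b, ?_⟩
      rw [hab, Matrix.conjTranspose_kronecker, ← Matrix.mul_kronecker_mul,
        ← Matrix.mul_kronecker_mul]
      simp

/-! ### Limits of LOCC measurements are POVMs -/

section Limits

variable {ι : Type} [DecidableEq ι] {dA dB : ℕ} {M : ι → BipOp dA dB}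

theorem IsAsymptoticLOCC.sum_eq_one [Fintype ι] (h : IsAsymptoticLOCC M) : ∑ i, M i = 1 := by
  obtain ⟨P, hP⟩ := h
  have hc : Continuous fun X : ι → BipOp dA dB => ∑ i, X i :=
    continuous_finsetSum _ fun i _ => continuous_apply i
  refine tendsto_nhds_unique ((hc.tendsto M).comp hP) ?_
  simp only [Function.comp_def, sum_povm]
  exact tendsto_const_nhds

theorem IsAsymptoticLOCC.posSemidef (h : IsAsymptoticLOCC M) (i : ι) : (M i).PosSemidef := by
  obtain ⟨P, hP⟩ := h
  have hPi : Filter.Tendsto (fun t => (P t).povm i) Filter.atTop (nhds (M i)) :=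
    (tendsto_pi_nhds.mp hP) i
  refine Matrix.PosSemidef.of_dotProduct_mulVec_nonneg ?_ fun x => ?_
  · refine tendsto_nhds_unique ((continuous_id.matrix_conjTranspose.tendsto (M i)).comp hPi) ?_
    simpa only [Function.comp_def, id, (povm_posSemidef _ _).1.eq] using hPi
  · have hc : Continuous fun X : BipOp dA dB => star x ⬝ᵥ (X *ᵥ x) :=
      continuous_const.dotProduct (continuous_id.matrix_mulVec continuous_const)
    exact ge_of_tendsto' ((hc.tendsto (M i)).comp hPi) fun t =>
      (povm_posSemidef (P t) i).dotProduct_mulVec_nonneg x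

end Limits

end LOCC

/-! ### From states to projectors -/

theorem mainTheorem2 (dA dB n : ℕ) (ρ : Fin n → LOCC.BipOp dA dB)
    (hρ : LOCC.IsFullOrthogonalSet ρ) (i₀ : Fin n)
    (hprod : ∀ i, i ≠ i₀ → ∃ (σ : Matrix (Fin dA) (Fin dA) ℂ) (τ : Matrix (Fin dB) (Fin dB) ℂ),
      ρ i = σ ⊗ₖ τ)
    (hasymp : ∃ M : Fin n → LOCC.BipOp dA dB, LOCC.IsAsymptoticLOCC M ∧ LOCC.Discriminates M ρ) :
    ∃ M : Fin n → LOCC.BipOp dA dB, LOCC.IsFiniteLOCC M ∧ LOCC.Discriminates M ρ := by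
  obtain ⟨M, hM, hdisc⟩ := hasymp
  -- The given limit measurement is itself in finite LOCC; no other one is needed.
  refine ⟨M, ?_, hdisc⟩
  have hoff : ∀ i j, j ≠ i → M j * ρ i = 0 := fun i j hij =>
    LOCC.mul_eq_zero_of_trace_mul_eq_zero (hM.posSemidef j) (hρ.isState i).1
      (by rw [hdisc, if_neg hij])
  have hdiag : ∀ i, M i * ρ i = ρ i := by
    intro i
    have h := congrArg (fun X => X * ρ i) hM.sum_eq_one
    simp only [Matrix.sum_mul, Matrix.one_mul] at h
    rwa [Finset.sum_eq_single i (fun j _ hj => hoff i j hj) (by simp)] at h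
  have hunit : IsUnit (∑ i, ρ i) := by
    rw [← Matrix.linearIndependent_cols_iff_isUnit, linearIndependent_iff_card_eq_finrank_span,
      Set.finrank, ← Matrix.rank_eq_finrank_span_cols, hρ.fullRank]
    simp
  -- As the sum of the states is invertible, these equations determine `M`; right cancellation then
  -- gives projectivity.
  have hMR : ∀ j, M j * ∑ i, ρ i = ρ j := by
    intro j
    rw [Matrix.mul_sum, Finset.sum_eq_single j (fun i _ hi => hoff i j hi.symm) (by simp), hdiag]
  have hQ : LOCC.IsProjective M := by
    refine ⟨fun i => (hM.posSemidef i).1, fun i => ?_, fun i j hij => ?_, hM.sum_eq_one⟩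
    · apply hunit.mul_right_cancel
      rw [Matrix.mul_assoc, hMR, hdiag]
    · apply hunit.mul_right_cancel
      rw [Matrix.mul_assoc, hMR, hoff j i hij, Matrix.zero_mul]
  refine hM.isFiniteLOCC hQ i₀ fun i hi => ?_
  obtain ⟨σ, τ, hστ⟩ := hprod i hi
  obtain ⟨a, x, haH, haσ, hax⟩ := LOCC.exists_range_projector σ
  obtain ⟨b, y, hbH, hbτ, hby⟩ := LOCC.exists_range_projector τ
  refine ⟨a, b, ?_⟩
  obtain ⟨u, hu⟩ := hunit
  -- `M i` and `a ⊗ₖ b` are hermitian with the range of `ρ i` as common range. Each fixes the range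
  -- of the other, and taking adjoints identifies them.
  have hMz : M i = ρ i * (u⁻¹ : (LOCC.BipOp dA dB)ˣ) := by
    rw [← hMR i, ← hu, Matrix.mul_assoc, Units.mul_inv, Matrix.mul_one]
  have h1 : M i * (a ⊗ₖ b) = a ⊗ₖ b := by
    have : a ⊗ₖ b = ρ i * (x ⊗ₖ y) := by
      rw [hστ, ← Matrix.mul_kronecker_mul, ← hax, ← hby]
    rw [this, ← Matrix.mul_assoc, hdiag]
  have h2 : (a ⊗ₖ b) * M i = M i := by
    rw [hMz, ← Matrix.mul_assoc]
    congr 1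
    rw [hστ, ← Matrix.mul_kronecker_mul, haσ, hbτ]
  have h3 := congrArg Matrix.conjTranspose h1
  rw [Matrix.conjTranspose_mul, Matrix.conjTranspose_kronecker, haH, hbH,
    hQ.conjTranspose_eq] at h3
  rw [← h2, h3]
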